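/- **Setting.** Let $n\ge 1$, $\Omega=(0,1)^n$, let $f>0$ be continuous on $\overline\Omega$, let $g$ be continuous on $\partial\Omega$ with an extension to a convex function in $C(\overline\Omega)$, and let $u$ be the convex viscosity solution in $C(\overline\Omega)$ of $\det D^2u=f$ in $\Omega$, $u=g$ on $\partial\Omega$. Let $\Omega_r\subset\Omega$ be an open set on which $u$ is $C^2$. For $h>0$ with $1/h\in\mathbb Z$ put $\mathbb Z_h=h\mathbb Z^n$, $\Omega^h=\overline\Omega\cap\mathbb Z_h$, $\Omega_0^h=\Omega\cap\mathbb Z_h$, $\partial\Omega^h=\Omega^h\setminus\Omega_0^h$, $\Omega_r^h=\overline{\Omega_r}\cap\mathbb Z_h$; $r_h$ denotes restriction to the grid. **Discrete operators.** Let $\partial^i_\pm$ be the forward and backward difference quotients with step $h$ in direction $e^i$, $D_hv=(\partial^i_+v)_i$, $\mathcal H_dv=(\partial^j_-\partial^i_+v)_{i,j}$, $\operatorname{sym}A=(A+A^T)/2$, $\operatorname{div}_h w=\sum_i\partial^i_-w^i$, and $$M_r[v]=\tfrac1n\operatorname{div}_h\big[(\operatorname{cof}\operatorname{sym}\mathcal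 H_dv)^TD_hv\big].$$ Let $\Omega_{r,0}^h$ be the set of points of $\Omega_r^h$ at which $\mathcal H_d$ is defined for functions on $\Omega_r^h$ and $M_r$ is defined for functions on $\Omega^h$; put $\partial\Omega_r^h=\Omega_r^h\setminus\Omega_{r,0}^h$ and $\Omega_s^h=\Omega_0^h\setminus\Omega_{r,0}^h$. With $\delta_\alpha v(x)=\dfrac{v(x+\alpha)-2v(x)+v(x-\alpha)}{|\alpha|^2}$ ($|\alpha|$ Euclidean), let $$\lambda_1^h[v](x)=\min_{\alpha}\delta_\alpha v(x),\qquad M_s^+[v](x)=\min_{(\alpha_1,\dots,\alpha_n)}\prod_{i=1}^n\max(\delta_{\alpha_i}v(x),0),$$ over the $\alpha\ne0$ with $x\pm\alpha\in\Omega^h$, and over the orthogonal bases of $\mathbb R^n$ consisting of such vectors. Let $M_r^+=\max(M_r,0)$ and $|v|_{1,h}=\big(\sum_i h^n\sum_{x\in\Omega_{r,0}^h}|\partial^i_+v(x)|^2\big)^{1/2}$. **The hybrid discretization.** A mesh function $v$ on $\Omega^h$ is a solution of the hybrid discretization if $\lambda_1^h[v]\ge0$ on $\Omega_s^h$, $\operatorname{sym}\mathcal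 H_dv\ge0$ on $\Omega_{r,0}^h$, $M_s^+[v]=f$ on $\Omega_s^h$, $M_r^+[v]=f$ on $\Omega_{r,0}^h$, and $v=g$ on $\partial\Omega^h$. Given a constant $K>0$, *the (local) solution* $u^h$ is a solution that lies in the ball $B_\rho(r_h(u))$, $\rho=Kh^{2+n/2}$, of the mesh functions $v$ with $|v-r_h(u)|_{1,h}\le\rho$, $v=g$ on $\partial\Omega^h$ and $v=u$ on $\partial\Omega_r^h$. **Theorem.** For every $K>0$ there are constants $C>0$ and $h_0>0$, independent of $h$, such that for every $h<h_0$ as above: 1. every solution $u^h$ of the hybrid discretization that lies in $B_\rho(r_h(u))$, $\rho=Kh^{2+n/2}$, satisfies $$\max_{\Omega_0^h}|u^h|\le C\qquad\text{and}\qquad |u^h(x)-u(x)|\le C\,h^2\quad\text{for } x\in\Omega_{r,0}^h;$$ 2. every solution $v$ of the hybrid discretization (in the ball or not) with $|v|\le b$ on $\Omega_{r,0}^h$, where $b\ge0$, satisfies $|v|\le b+C$ on $\Omega_s^h$. -/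

import Mathlib

open Set

noncomputable section

namespace HybridMA

/-! ### The domain, the data and viscosity solutions -/

/-- The open unit cube `Ω = (0,1)ⁿ`. -/
def openCube (n : ℕ) : Set (Fin n → ℝ) := {x | ∀ i, 0 < x i ∧ x i < 1}

/-- The closed unit cube, that is, the closure of `Ω`. -/
def closedCube (n : ℕ) : Set (Fin n → ℝ) := {x | ∀ i, 0 ≤ x i ∧ x i ≤ 1}

/-- The boundary of the unit cube. -/
def cubeBoundary (n : ℕ) : Set (Fin n → ℝ) := closedCube n \ openCube n

/-- The Hessian matrix of `φ` at `x`. -/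
def hessian {n : ℕ} (φ : (Fin n → ℝ) → ℝ) (x : Fin n → ℝ) : Matrix (Fin n) (Fin n) ℝ :=
  Matrix.of fun i j => iteratedFDeriv ℝ 2 φ x ![Pi.single i 1, Pi.single j 1]

/-- `u` is a (convex) viscosity solution of `det D²u = f` in `Ω`, `u = g` on `∂Ω`. Values of `u`
outside the closed cube play no role. -/
structure IsViscositySolution {n : ℕ} (f g u : (Fin n → ℝ) → ℝ) : Prop where
  continuousOn : ContinuousOn u (closedCube n)
  convexOn : ConvexOn ℝ (closedCube n) u
  boundary : ∀ x ∈ cubeBoundary n, u x = g x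
  subsolution : ∀ φ : (Fin n → ℝ) → ℝ, ContDiffOn ℝ 2 φ (openCube n) → ∀ x₀ ∈ openCube n,
    IsLocalMax (fun x => u x - φ x) x₀ → f x₀ ≤ (hessian φ x₀).det
  supersolution : ∀ φ : (Fin n → ℝ) → ℝ, ContDiffOn ℝ 2 φ (openCube n) → ∀ x₀ ∈ openCube n,
    IsLocalMin (fun x => u x - φ x) x₀ → (hessian φ x₀).PosSemidef → (hessian φ x₀).det ≤ f x₀

/-! ### The grid

The lattice `ℤ_h = {x : x_i / h ∈ ℤ}` is parametrized by `k ↦ h k`, `k ∈ ℤⁿ`. A mesh function is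
given by its values at the indices `k`; only the values at indices in `Ω^h` are ever used. -/

/-- Admissible mesh sizes: `h > 0` and `1 / h` is an integer. -/
def IsMeshSize (h : ℝ) : Prop := 0 < h ∧ ∃ m : ℤ, 1 / h = m

/-- The lattice point `h k`. -/
def pt {n : ℕ} (h : ℝ) (k : Fin n → ℤ) : Fin n → ℝ := fun i => h * (k i : ℝ)

/-- Mesh functions. -/
abbrev Mesh (n : ℕ) := (Fin n → ℤ) → ℝ

/-- The restriction operator `r_h`. -/
def restr {n : ℕ} (h : ℝ) (w : (Fin n → ℝ) → ℝ) : Mesh n := fun k => w (pt h k)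

/-- `Ω^h`: lattice points of the closed cube. -/
def grid (n : ℕ) (h : ℝ) : Set (Fin n → ℤ) := {k | pt h k ∈ closedCube n}

/-- `Ω_0^h`: lattice points of the open cube. -/
def gridInt (n : ℕ) (h : ℝ) : Set (Fin n → ℤ) := {k | pt h k ∈ openCube n}

/-- `∂Ω^h = Ω^h \ Ω_0^h`. -/
def gridBdry (n : ℕ) (h : ℝ) : Set (Fin n → ℤ) := grid n h \ gridInt n h

/-- The `i`-th unit lattice vector. -/
def e {n : ℕ} (i : Fin n) : Fin n → ℤ := Pi.single i 1

/-! ### The standard finite difference discretization -/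

/-- Forward difference quotient in the direction `i`. -/
def dPlus {n : ℕ} (h : ℝ) (i : Fin n) (v : Mesh n) : Mesh n := fun k => (v (k + e i) - v k) / h

/-- Backward difference quotient in the direction `i`. -/
def dMinus {n : ℕ} (h : ℝ) (i : Fin n) (v : Mesh n) : Mesh n := fun k => (v k - v (k - e i)) / h

/-- The discrete Hessian, with entries `∂^j_- ∂^i_+ v`. -/
def discHessian {n : ℕ} (h : ℝ) (v : Mesh n) (k : Fin n → ℤ) : Matrix (Fin n) (Fin n) ℝ :=
  Matrix.of fun i j => dMinus h j (dPlus h i v) k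

/-- The symmetric part of a matrix. -/
def symPart {n : ℕ} (A : Matrix (Fin n) (Fin n) ℝ) : Matrix (Fin n) (Fin n) ℝ :=
  (1 / 2 : ℝ) • (A + A.transpose)

/-- The cofactor matrix (Mathlib's adjugate is its transpose). -/
def cof {n : ℕ} (A : Matrix (Fin n) (Fin n) ℝ) : Matrix (Fin n) (Fin n) ℝ := A.adjugate.transpose

/-- The vector field `(cof sym H_d v)ᵀ D_h v`. -/
def flux {n : ℕ} (h : ℝ) (v : Mesh n) (k : Fin n → ℤ) : Fin n → ℝ :=
  ((cof (symPart (discHessian h v k))).transpose).mulVec fun i => dPlus h i v k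

/-- `M_r[v] = (1/n) div_h [ (cof sym H_d v)ᵀ D_h v ]`. -/
def Mr {n : ℕ} (h : ℝ) (v : Mesh n) (k : Fin n → ℤ) : ℝ :=
  (1 / (n : ℝ)) * ∑ i, dMinus h i (fun l => flux h v l i) k

/-- `Ω_r^h`: lattice points of the closure of `Ω_r`. -/
def regGrid {n : ℕ} (h : ℝ) (Ωr : Set (Fin n → ℝ)) : Set (Fin n → ℤ) := {k | pt h k ∈ closure Ωr}

/-- All points that enter the discrete Hessian at `k` belong to `T`. -/
def HessDefined {n : ℕ} (T : Set (Fin n → ℤ)) (k : Fin n → ℤ) : Prop :=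
  k ∈ T ∧ ∀ i j, k + e i ∈ T ∧ k - e j ∈ T ∧ k + e i - e j ∈ T

/-- `Ω_{r,0}^h`: the points of `Ω_r^h` at which the discrete Hessian of a function on `Ω_r^h` is
defined. The second condition says that `M_r[v]` at the point depends only on the values of `v` on
`Ω^h`, so that the discrete operator makes sense there; it is automatic for small `h` if the closure
of `Ω_r` is contained in `Ω`. -/
def regInt {n : ℕ} (h : ℝ) (Ωr : Set (Fin n → ℝ)) : Set (Fin n → ℤ) :=
  {k | HessDefined (regGrid h Ωr) k ∧
    ∀ v w : Mesh n, EqOn v w (grid n h) → Mr h v k = Mr h w k}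

/-- The discrete boundary of the regular part: `Ω_r^h \ Ω_{r,0}^h`. -/
def regBdry {n : ℕ} (h : ℝ) (Ωr : Set (Fin n → ℝ)) : Set (Fin n → ℤ) :=
  regGrid h Ωr \ regInt h Ωr

/-- `Ω_s^h = Ω_0^h \ Ω_{r,0}^h`. -/
def singInt {n : ℕ} (h : ℝ) (Ωr : Set (Fin n → ℝ)) : Set (Fin n → ℤ) :=
  gridInt n h \ regInt h Ωr

/-- The discrete semi-norm `|v|_{1,h}`, which only takes into account the points of `Ω_{r,0}^h`
(a finite set for `h > 0`). -/
def seminorm1 {n : ℕ} (h : ℝ) (Ωr : Set (Fin n → ℝ)) (v : Mesh n) : ℝ :=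
  Real.sqrt (∑ i, h ^ n * ∑ᶠ k ∈ regInt h Ωr, (dPlus h i v k) ^ 2)

/-! ### The monotone scheme -/

/-- Squared Euclidean length of the vector `h a`. -/
def sqLen {n : ℕ} (h : ℝ) (a : Fin n → ℤ) : ℝ := ∑ i, (h * (a i : ℝ)) ^ 2

/-- Second difference quotient in the direction `α = h a`. -/
def secondDiff {n : ℕ} (h : ℝ) (v : Mesh n) (k a : Fin n → ℤ) : ℝ :=
  (v (k + a) - 2 * v k + v (k - a)) / sqLen h a

/-- Nonzero directions `α = h a` for which both `x + α` and `x - α` are in `Ω^h`. -/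
def directions {n : ℕ} (h : ℝ) (k : Fin n → ℤ) : Set (Fin n → ℤ) :=
  {a | a ≠ 0 ∧ k + a ∈ grid n h ∧ k - a ∈ grid n h}

/-- The discretization `λ_1^h[v]` of the smallest eigenvalue of the Hessian. -/
def lambda1 {n : ℕ} (h : ℝ) (v : Mesh n) (k : Fin n → ℤ) : ℝ :=
  ⨅ a : directions h k, secondDiff h v k a

/-- `W_h(x)`: orthogonal bases `(α_1, …, α_n)` of `ℝⁿ`, `α_i = h (a i)`, with `x ± α_i ∈ Ω^h`
(`n` nonzero pairwise orthogonal vectors form a basis). -/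
def orthBases {n : ℕ} (h : ℝ) (k : Fin n → ℤ) : Set (Fin n → Fin n → ℤ) :=
  {a | (∀ i, a i ∈ directions h k) ∧ ∀ i j, i ≠ j → ∑ l, a i l * a j l = 0}

/-- `M_s^+[v]`. -/
def MsPlus {n : ℕ} (h : ℝ) (v : Mesh n) (k : Fin n → ℤ) : ℝ :=
  ⨅ a : orthBases h k, ∏ i, max (secondDiff h v k (a.1 i)) 0

/-! ### The hybrid discretization -/

open Classical in
/-- The hybrid operator `F_h` on `Ω_0^h`. -/
def Fh {n : ℕ} (h : ℝ) (Ωr : Set (Fin n → ℝ)) (f : (Fin n → ℝ) → ℝ) (v : Mesh n)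
    (k : Fin n → ℤ) : ℝ :=
  if k ∈ regInt h Ωr then max (Mr h v k) 0 - restr h f k else MsPlus h v k - restr h f k

/-- Discrete convex mesh functions. -/
def DiscreteConvex {n : ℕ} (h : ℝ) (Ωr : Set (Fin n → ℝ)) (v : Mesh n) : Prop :=
  (∀ k ∈ singInt h Ωr, 0 ≤ lambda1 h v k) ∧
    ∀ k ∈ regInt h Ωr, (symPart (discHessian h v k)).PosSemidef

/-- `v` solves the hybrid discretization. -/
structure IsHybridSolution {n : ℕ} (h : ℝ) (Ωr : Set (Fin n → ℝ)) (f g : (Fin n → ℝ) → ℝ)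
    (v : Mesh n) : Prop where
  convex : DiscreteConvex h Ωr v
  equation : ∀ k ∈ gridInt n h, Fh h Ωr f v k = 0
  boundary : ∀ k ∈ gridBdry n h, v k = restr h g k

/-- The ball `B_ρ(r_h(u))` of mesh functions. -/
def meshBall {n : ℕ} (h : ℝ) (Ωr : Set (Fin n → ℝ)) (g u : (Fin n → ℝ) → ℝ) (ρ : ℝ) :
    Set (Mesh n) :=
  {v | seminorm1 h Ωr (v - restr h u) ≤ ρ ∧ (∀ k ∈ gridBdry n h, v k = restr h g k) ∧
    ∀ k ∈ regBdry h Ωr, v k = restr h u k}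

end HybridMA

end

namespace HybridMA

/-! Two independent arguments, one for each part of the grid.

On `Ω_s^h` quadratic barriers localize extrema. A maximum of `v + |x|²` cannot lie there, since
second differences would be negative, against `λ_1^h[v] ≥ 0`. If `|f| ≤ F`, a minimum of `v -
(F+1)|x|²` cannot lie there either, since all second differences would be at least `2(F+1)` and
`M_s^+[v]` would exceed `f`. Both extrema therefore sit in `Ω_{r,0}^h` or on `∂Ω^h`, where `v` is
controlled; as `|x|² ≤ n` on the cube, the barriers cost only a constant (`le_of_mem_grid`,
`ge_of_mem_grid`).

On `Ω_{r,0}^h` the ball alone suffices: its radius forces every difference quotient of `v - u` to be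
at most `K h²`. Summing increments along a coordinate line until it meets `∂Ω_r^h`, where `v = u`,
takes at most `1/h + 1` steps of size `K h³` and gives the `O(h²)` bound (`abs_le_of_increment_le`).
-/

lemma IsMeshSize.exists_nat {h : ℝ} (hh : IsMeshSize h) : ∃ m : ℕ, 0 < m ∧ h * m = 1 := by
  obtain ⟨h0, m, hm⟩ := hh
  have hpos : (0 : ℝ) < m := hm ▸ one_div_pos.2 h0
  have hpos' : 0 < m := by exact_mod_cast hpos
  lift m to ℕ using hpos'.le
  refine ⟨m, by exact_mod_cast hpos', ?_⟩
  have : ((m : ℤ) : ℝ) = m := by norm_cast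
  rw [← this, ← hm]
  field_simp

lemma mem_grid_iff {n : ℕ} {h : ℝ} (h0 : 0 < h) {m : ℕ} (hm : h * m = 1) (k : Fin n → ℤ) :
    k ∈ grid n h ↔ ∀ i, 0 ≤ k i ∧ k i ≤ m := by
  refine forall_congr' fun i => and_congr ?_ ?_
  · simp only [pt]
    rw [mul_nonneg_iff_of_pos_left h0]
    norm_cast
  · simp only [pt]
    rw [← hm, mul_le_mul_iff_right₀ h0]
    norm_cast

lemma mem_gridInt_iff {n : ℕ} {h : ℝ} (h0 : 0 < h) {m : ℕ} (hm : h * m = 1) (k : Fin n → ℤ) :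
    k ∈ gridInt n h ↔ ∀ i, 0 < k i ∧ k i < m := by
  refine forall_congr' fun i => and_congr ?_ ?_
  · simp only [pt]
    rw [mul_pos_iff_of_pos_left h0]
    norm_cast
  · simp only [pt]
    rw [← hm, mul_lt_mul_iff_right₀ h0]
    norm_cast

lemma grid_finite {n : ℕ} {h : ℝ} (hh : IsMeshSize h) : (grid n h).Finite := by
  obtain ⟨m, -, hm⟩ := IsMeshSize.exists_nat hh
  refine (Set.finite_Icc (0 : Fin n → ℤ) (fun _ => (m : ℤ))).subset fun k hk => ?_
  rw [mem_grid_iff hh.1 hm] at hk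
  exact ⟨fun i => (hk i).1, fun i => (hk i).2⟩

lemma grid_nonempty {n : ℕ} {h : ℝ} : (grid n h).Nonempty :=
  ⟨0, fun i => by simp [pt]⟩

lemma openCube_subset_closedCube (n : ℕ) : openCube n ⊆ closedCube n :=
  fun _ hx i => ⟨(hx i).1.le, (hx i).2.le⟩

lemma closedCube_eq_Icc (n : ℕ) : closedCube n = Set.Icc 0 1 := by
  ext x
  exact forall_and

lemma isCompact_closedCube (n : ℕ) : IsCompact (closedCube n) := by
  rw [closedCube_eq_Icc]
  exact isCompact_Icc

/-- A continuous function on the closed cube is bounded. -/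
lemma exists_abs_le_closedCube {n : ℕ} {w : (Fin n → ℝ) → ℝ}
    (hw : ContinuousOn w (closedCube n)) : ∃ B : ℝ, 0 ≤ B ∧ ∀ x ∈ closedCube n, |w x| ≤ B := by
  obtain ⟨B, hB⟩ := (isCompact_closedCube n).exists_bound_of_continuousOn hw
  exact ⟨|B|, abs_nonneg _, fun x hx => (hB x hx).trans (le_abs_self B)⟩

lemma regGrid_subset_grid {n : ℕ} {h : ℝ} {Ωr : Set (Fin n → ℝ)} (hsub : Ωr ⊆ openCube n) :
    regGrid h Ωr ⊆ grid n h := fun _ hk =>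
  closure_minimal (hsub.trans (openCube_subset_closedCube n)) (isCompact_closedCube n).isClosed hk

lemma regInt_subset_regGrid {n : ℕ} {h : ℝ} {Ωr : Set (Fin n → ℝ)} :
    regInt h Ωr ⊆ regGrid h Ωr := fun _ hk => hk.1.1

lemma e_ne_zero {n : ℕ} (i : Fin n) : (e i : Fin n → ℤ) ≠ 0 := by
  simp [e]

lemma e_mem_directions {n : ℕ} {h : ℝ} (hh : IsMeshSize h) {k : Fin n → ℤ}
    (hk : k ∈ gridInt n h) (i : Fin n) : e i ∈ directions h k := by
  obtain ⟨m, -, hm⟩ := IsMeshSize.exists_nat hh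
  rw [mem_gridInt_iff hh.1 hm] at hk
  refine ⟨e_ne_zero i, ?_, ?_⟩ <;>
  · rw [mem_grid_iff hh.1 hm]
    intro j
    have := hk j
    by_cases hj : j = i
    · subst hj
      simp only [Pi.add_apply, Pi.sub_apply, e, Pi.single_eq_same]
      omega
    · simp only [Pi.add_apply, Pi.sub_apply, e, Pi.single_eq_of_ne hj]
      omega

lemma directions_finite {n : ℕ} {h : ℝ} (hh : IsMeshSize h) (k : Fin n → ℤ) :
    (directions h k).Finite :=
  ((grid_finite (n := n) hh).preimage (add_right_injective k).injOn).subset fun _ ha => ha.2.1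

/-- The coordinate basis is admissible in the monotone scheme. -/
lemma orthBases_nonempty {n : ℕ} {h : ℝ} (hh : IsMeshSize h) {k : Fin n → ℤ}
    (hk : k ∈ gridInt n h) : (orthBases h k).Nonempty := by
  refine ⟨fun i => e i, fun i => e_mem_directions hh hk i, fun i j hij => ?_⟩
  refine Finset.sum_eq_zero fun l _ => ?_
  by_cases hl : l = i
  · subst hl
    simp [e, Pi.single_eq_of_ne hij]
  · simp [e, Pi.single_eq_of_ne hl]

/-! ### Quadratic barriers and second differences -/

lemma sqLen_pos {n : ℕ} {h : ℝ} (h0 : 0 < h) {a : Fin n → ℤ} (ha : a ≠ 0) : 0 < sqLen h a := by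
  obtain ⟨i, hi⟩ := Function.ne_iff.1 ha
  refine Finset.sum_pos' (fun _ _ => sq_nonneg _) ⟨i, Finset.mem_univ _, ?_⟩
  have : (a i : ℝ) ≠ 0 := by exact_mod_cast hi
  positivity

lemma sqLen_nonneg {n : ℕ} (h : ℝ) (a : Fin n → ℤ) : 0 ≤ sqLen h a :=
  Finset.sum_nonneg fun _ _ => sq_nonneg _

lemma sqLen_le_of_mem_grid {n : ℕ} {h : ℝ} {k : Fin n → ℤ} (hk : k ∈ grid n h) :
    sqLen h k ≤ n := by
  have : sqLen h k ≤ ∑ _i : Fin n, (1 : ℝ) :=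
    Finset.sum_le_sum fun i _ => pow_le_one₀ (hk i).1 (hk i).2
  simpa using this

/-- The parallelogram law: every second difference quotient of `|x|²` equals 2, whatever the
direction. -/
lemma sqLen_parallelogram {n : ℕ} (h : ℝ) (k a : Fin n → ℤ) :
    sqLen h (k + a) - 2 * sqLen h k + sqLen h (k - a) = 2 * sqLen h a := by
  simp only [sqLen, Finset.mul_sum, ← Finset.sum_sub_distrib, ← Finset.sum_add_distrib]
  refine Finset.sum_congr rfl fun i _ => ?_
  push_cast [Pi.add_apply, Pi.sub_apply]
  ring

/-- At a minimum of `v - A |x|²` all the second difference quotients of `v` are at least `2 A`. -/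
lemma two_mul_le_secondDiff {n : ℕ} {h : ℝ} (h0 : 0 < h) {v : Mesh n} {A : ℝ} {k : Fin n → ℤ}
    (hmin : ∀ l ∈ grid n h, v k - A * sqLen h k ≤ v l - A * sqLen h l) {a : Fin n → ℤ}
    (ha : a ∈ directions h k) : 2 * A ≤ secondDiff h v k a := by
  rw [secondDiff, le_div_iff₀ (sqLen_pos h0 ha.1)]
  have h1 := hmin _ ha.2.1
  have h2 := hmin _ ha.2.2
  have h3 := congrArg (A * ·) (sqLen_parallelogram h k a)
  linarith

/-- At a maximum of `v + |x|²` the second difference quotients of `v` are negative. -/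
lemma secondDiff_neg {n : ℕ} {h : ℝ} (h0 : 0 < h) {v : Mesh n} {k : Fin n → ℤ}
    (hmax : ∀ l ∈ grid n h, v l + sqLen h l ≤ v k + sqLen h k) {a : Fin n → ℤ}
    (ha : a ∈ directions h k) : secondDiff h v k a < 0 := by
  refine div_neg_of_neg_of_pos ?_ (sqLen_pos h0 ha.1)
  linarith [hmax _ ha.2.1, hmax _ ha.2.2, sqLen_parallelogram h k a, sqLen_pos h0 ha.1]

lemma secondDiff_nonneg_of_lambda1 {n : ℕ} {h : ℝ} (hh : IsMeshSize h) {v : Mesh n}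
    {k : Fin n → ℤ} (hk : 0 ≤ lambda1 h v k) {a : Fin n → ℤ} (ha : a ∈ directions h k) :
    0 ≤ secondDiff h v k a := by
  -- Finiteness makes the infimum a genuine lower bound; a real infimum that is unbounded below
  -- defaults to 0.
  have : Finite (directions h k) := (directions_finite hh k).to_subtype
  exact hk.trans (ciInf_le (f := fun a : directions h k => secondDiff h v k a)
    (Set.finite_range _).bddBelow ⟨a, ha⟩)

/-- If all second difference quotients are at least `c ≥ 0`, then `M_s^+[v] ≥ cⁿ`. -/
lemma pow_le_MsPlus {n : ℕ} {h : ℝ} (hh : IsMeshSize h) {v : Mesh n} {k : Fin n → ℤ}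
    (hk : k ∈ gridInt n h) {c : ℝ} (hc : 0 ≤ c)
    (hv : ∀ a ∈ directions h k, c ≤ secondDiff h v k a) : c ^ n ≤ MsPlus h v k := by
  have : Nonempty (orthBases h k) := (orthBases_nonempty hh hk).to_subtype
  refine le_ciInf fun a => ?_
  calc c ^ n = ∏ _i : Fin n, c := by simp
    _ ≤ _ := Finset.prod_le_prod (fun _ _ => hc)
      fun i _ => (hv _ (a.2.1 i)).trans (le_max_left _ _)

lemma IsHybridSolution.MsPlus_eq {n : ℕ} {h : ℝ} {Ωr : Set (Fin n → ℝ)} {f g : (Fin n → ℝ) → ℝ}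
    {v : Mesh n} (hv : IsHybridSolution h Ωr f g v) {k : Fin n → ℤ} (hk : k ∈ singInt h Ωr) :
    MsPlus h v k = f (pt h k) := by
  have := hv.equation k hk.1
  rw [Fh, if_neg hk.2] at this
  exact sub_eq_zero.1 this

/-- A grid point outside `Ω_s^h` lies in `Ω_{r,0}^h` or on the boundary, so that bounds on these
sets bound the mesh function there. -/
lemma abs_le_of_notMem_singInt {n : ℕ} {h : ℝ} {Ωr : Set (Fin n → ℝ)}
    {f g : (Fin n → ℝ) → ℝ} {v : Mesh n} (hv : IsHybridSolution h Ωr f g v) {b B : ℝ} (hb : 0 ≤ b)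
    (hB : 0 ≤ B) (hvb : ∀ k ∈ regInt h Ωr, |v k| ≤ b) (hgB : ∀ x ∈ cubeBoundary n, |g x| ≤ B)
    {k : Fin n → ℤ} (hk : k ∈ grid n h) (hks : k ∉ singInt h Ωr) : |v k| ≤ b + B := by
  by_cases hr : k ∈ regInt h Ωr
  · linarith [hvb k hr]
  · have hi : k ∉ gridInt n h := fun hi => hks ⟨hi, hr⟩
    rw [hv.boundary k ⟨hk, hi⟩]
    exact (hgB (pt h k) ⟨hk, hi⟩).trans (le_add_of_nonneg_left hb)

/-- The maximum principle for the discrete convex functions, with a quadratic barrier. -/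
lemma IsHybridSolution.le_of_mem_grid {n : ℕ} (hn : 0 < n) {h : ℝ} (hh : IsMeshSize h)
    {Ωr : Set (Fin n → ℝ)} {f g : (Fin n → ℝ) → ℝ} {v : Mesh n}
    (hv : IsHybridSolution h Ωr f g v) {b B : ℝ} (hb : 0 ≤ b) (hB : 0 ≤ B)
    (hvb : ∀ k ∈ regInt h Ωr, |v k| ≤ b) (hgB : ∀ x ∈ cubeBoundary n, |g x| ≤ B)
    {k : Fin n → ℤ} (hk : k ∈ grid n h) : v k ≤ b + B + n := by
  obtain ⟨l, hl, hmax⟩ := (grid_finite (n := n) hh).exists_maximalFor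
    (fun l => v l + sqLen h l) _ grid_nonempty
  have hmax' : ∀ j ∈ grid n h, v j + sqLen h j ≤ v l + sqLen h l := fun j hj =>
    (le_total _ _).elim id fun h' => hmax hj h'
  have hls : l ∉ singInt h Ωr := fun hls =>
    have hd := e_mem_directions hh hls.1 ⟨0, hn⟩
    (secondDiff_nonneg_of_lambda1 hh (hv.convex.1 l hls) hd).not_gt (secondDiff_neg hh.1 hmax' hd)
  have h1 := (abs_le.1 (abs_le_of_notMem_singInt hv hb hB hvb hgB hl hls)).2
  linarith [hmax' k hk, sqLen_nonneg h k, sqLen_le_of_mem_grid hl]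

/-- The lower bound: comparison with a quadratic function whose determinant exceeds `f`. -/
lemma IsHybridSolution.ge_of_mem_grid {n : ℕ} (hn : 0 < n) {h : ℝ} (hh : IsMeshSize h)
    {Ωr : Set (Fin n → ℝ)} {f g : (Fin n → ℝ) → ℝ} {v : Mesh n}
    (hv : IsHybridSolution h Ωr f g v) {b B F : ℝ} (hb : 0 ≤ b) (hB : 0 ≤ B) (hF : 0 ≤ F)
    (hvb : ∀ k ∈ regInt h Ωr, |v k| ≤ b) (hgB : ∀ x ∈ cubeBoundary n, |g x| ≤ B)
    (hfF : ∀ x ∈ closedCube n, |f x| ≤ F)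
    {k : Fin n → ℤ} (hk : k ∈ grid n h) : -(b + B + (F + 1) * n) ≤ v k := by
  obtain ⟨l, hl, hmin⟩ := (grid_finite (n := n) hh).exists_minimalFor
    (fun l => v l - (F + 1) * sqLen h l) _ grid_nonempty
  have hmin' : ∀ j ∈ grid n h, v l - (F + 1) * sqLen h l ≤ v j - (F + 1) * sqLen h j :=
    fun j hj => (le_total _ _).elim id fun h' => hmin hj h'
  have hls : l ∉ singInt h Ωr := fun hls => by
    -- Since `c = 2(F+1) ≥ 1` and `n ≥ 1`, `cⁿ ≥ c > F ≥ f`.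
    have h1 := pow_le_MsPlus hh hls.1 (c := 2 * (F + 1)) (by linarith)
      fun a ha => two_mul_le_secondDiff hh.1 hmin' ha
    have h2 : 2 * (F + 1) ≤ (2 * (F + 1)) ^ n := le_self_pow₀ (by linarith) hn.ne'
    rw [hv.MsPlus_eq hls] at h1
    linarith [le_abs_self (f (pt h l)), hfF _ hl]
  have h1 := (abs_le.1 (abs_le_of_notMem_singInt hv hb hB hvb hgB hl hls)).1
  have h2 := mul_le_mul_of_nonneg_left (sqLen_le_of_mem_grid hl) (by linarith : 0 ≤ F + 1)
  have h3 := mul_nonneg (by linarith : 0 ≤ F + 1) (sqLen_nonneg h k)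
  linarith [hmin' k hk]

/-! ### Pointwise control from the discrete semi-norm -/

/-- In the ball of radius `ρ` in the discrete semi-norm, all difference quotients on `Ω_{r,0}^h`
are controlled. -/
lemma dPlus_sq_le_of_seminorm1_le {n : ℕ} {h ρ : ℝ} (hh : IsMeshSize h) {Ωr : Set (Fin n → ℝ)}
    (hsub : Ωr ⊆ openCube n) {w : Mesh n} (hw : seminorm1 h Ωr w ≤ ρ) {k : Fin n → ℤ}
    (hk : k ∈ regInt h Ωr) (i : Fin n) : h ^ n * (dPlus h i w k) ^ 2 ≤ ρ ^ 2 := by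
  have hfin : (regInt h Ωr).Finite := (grid_finite hh).subset
    (regInt_subset_regGrid.trans (regGrid_subset_grid hsub))
  have hhn : 0 ≤ h ^ n := pow_nonneg hh.1.le n
  have hnonneg : ∀ j : Fin n, 0 ≤ h ^ n * ∑ᶠ k ∈ regInt h Ωr, (dPlus h j w k) ^ 2 := fun j =>
    mul_nonneg hhn (finsum_nonneg fun _ => finsum_nonneg fun _ => sq_nonneg _)
  calc h ^ n * (dPlus h i w k) ^ 2
      ≤ h ^ n * ∑ᶠ k ∈ regInt h Ωr, (dPlus h i w k) ^ 2 := by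
        refine mul_le_mul_of_nonneg_left ?_ hhn
        rw [finsum_mem_eq_finite_toFinset_sum _ hfin]
        exact Finset.single_le_sum (f := fun k => (dPlus h i w k) ^ 2) (fun _ _ => sq_nonneg _)
          (hfin.mem_toFinset.2 hk)
    _ ≤ ∑ i, h ^ n * ∑ᶠ k ∈ regInt h Ωr, (dPlus h i w k) ^ 2 :=
        Finset.single_le_sum (f := fun i => h ^ n * ∑ᶠ k ∈ regInt h Ωr, (dPlus h i w k) ^ 2)
          (fun j _ => hnonneg j) (Finset.mem_univ i)
    _ = seminorm1 h Ωr w ^ 2 := (Real.sq_sqrt (Finset.sum_nonneg fun j _ => hnonneg j)).symm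
    _ ≤ ρ ^ 2 := pow_le_pow_left₀ (Real.sqrt_nonneg _) hw 2

/-- The `n/2` in the exponent of the radius exactly absorbs the weight `hⁿ` of a single term of the
semi-norm. -/
lemma abs_dPlus_le_of_seminorm1_le {n : ℕ} {h K : ℝ} (hh : IsMeshSize h) (hK : 0 ≤ K)
    {Ωr : Set (Fin n → ℝ)} (hsub : Ωr ⊆ openCube n) {w : Mesh n}
    (hw : seminorm1 h Ωr w ≤ K * h ^ (2 + (n : ℝ) / 2)) {k : Fin n → ℤ}
    (hk : k ∈ regInt h Ωr) (i : Fin n) : |dPlus h i w k| ≤ K * h ^ 2 := by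
  have h0 := hh.1
  have h1 := dPlus_sq_le_of_seminorm1_le hh hsub hw hk i
  have h2 : (h ^ (2 + (n : ℝ) / 2)) ^ 2 = h ^ n * (h ^ 2) ^ 2 := by
    rw [← Real.rpow_natCast (h ^ (2 + (n : ℝ) / 2)), ← Real.rpow_mul h0.le, ← pow_mul, ← pow_add,
      ← Real.rpow_natCast h]
    congr 1
    push_cast
    ring
  refine abs_le_of_sq_le_sq (le_of_mul_le_mul_left ?_ (pow_pos h0 n)) (by positivity)
  calc _ ≤ (K * h ^ (2 + (n : ℝ) / 2)) ^ 2 := h1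
    _ = h ^ n * (K * h ^ 2) ^ 2 := by rw [mul_pow, h2]; ring

/-- A discrete Poincaré inequality in the maximum norm: a mesh function that vanishes on
`∂Ω_r^h` is bounded by its increments along a coordinate direction. -/
lemma abs_le_of_increment_le {n : ℕ} {h D : ℝ} (h0 : 0 < h) {m : ℕ} (hm : h * m = 1) (hD : 0 ≤ D)
    {Ωr : Set (Fin n → ℝ)} (hsub : Ωr ⊆ openCube n) {w : Mesh n} (i : Fin n)
    (hw : ∀ k ∈ regBdry h Ωr, w k = 0)
    (hinc : ∀ k ∈ regInt h Ωr, |w (k + e i) - w k| ≤ D) (N : ℕ) :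
    ∀ k ∈ regInt h Ωr, (m : ℤ) < k i + N → |w k| ≤ N * D := by
  -- `N` bounds the steps left before the `i`-th index exceeds `m`; for `N = 0` no grid point
  -- qualifies.
  induction N with
  | zero =>
    intro k hk hN
    have := ((mem_grid_iff h0 hm k).1 (regGrid_subset_grid hsub (regInt_subset_regGrid hk)) i).2
    push_cast at hN
    omega
  | succ N ih =>
    intro k hk hN
    have hstep := abs_sub_le_iff.1 (hinc k hk)
    have hnext : |w (k + e i)| ≤ N * D := by
      by_cases hr : k + e i ∈ regInt h Ωr
      · refine ih _ hr ?_
        simp only [Pi.add_apply, e, Pi.single_eq_same]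
        push_cast at hN
        omega
      -- The discrete Hessian at `k` uses `k + e i`, so a step out of `Ω_{r,0}^h` stays in `Ω_r^h`
      -- and lands on `∂Ω_r^h`.
      · rw [hw _ ⟨(hk.1.2 i i).1, hr⟩, abs_zero]
        positivity
    rw [abs_le] at hnext ⊢
    push_cast
    constructor <;> linarith [hnext.1, hnext.2, hstep.1, hstep.2]

/-- Mesh functions in the ball `B_ρ(r_h(u))`, `ρ = K h^{2+n/2}`, are within `O(h²)` of `u` on
`Ω_{r,0}^h`. -/
lemma abs_sub_restr_le_of_mem_meshBall {n : ℕ} (hn : 0 < n) {h K : ℝ} (hh : IsMeshSize h)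
    (hK : 0 ≤ K) {Ωr : Set (Fin n → ℝ)} (hsub : Ωr ⊆ openCube n) {g u : (Fin n → ℝ) → ℝ}
    {v : Mesh n} (hv : v ∈ meshBall h Ωr g u (K * h ^ (2 + (n : ℝ) / 2))) {k : Fin n → ℤ}
    (hk : k ∈ regInt h Ωr) : |v k - restr h u k| ≤ 2 * K * h ^ 2 := by
  obtain ⟨m, hm0, hm⟩ := IsMeshSize.exists_nat hh
  have h0 := hh.1
  let i : Fin n := ⟨0, hn⟩
  have hinc : ∀ l ∈ regInt h Ωr,
      |(v - restr h u) (l + e i) - (v - restr h u) l| ≤ K * h ^ 2 * h := fun l hl => by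
    have := abs_dPlus_le_of_seminorm1_le hh hK hsub hv.1 hl i
    rwa [dPlus, abs_div, abs_of_pos h0, div_le_iff₀ h0] at this
  have hki := ((mem_grid_iff h0 hm k).1 (regGrid_subset_grid hsub (regInt_subset_regGrid hk)) i).1
  -- As `k i ≥ 0`, `m + 1` steps suffice from any starting point.
  have hmain := abs_le_of_increment_le h0 hm (by positivity) hsub i
    (fun l hl => sub_eq_zero.2 (hv.2.2 l hl)) hinc (m + 1) k hk (by push_cast; omega)
  have hm1 : (1 : ℝ) ≤ m := by exact_mod_cast hm0
  have hh1 : h ≤ 1 := hm ▸ le_mul_of_one_le_right h0.le hm1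
  calc |v k - restr h u k| ≤ ((m + 1 : ℕ) : ℝ) * (K * h ^ 2 * h) := hmain
    _ = K * h ^ 2 * (h * m + h) := by push_cast; ring
    _ ≤ K * h ^ 2 * 2 := mul_le_mul_of_nonneg_left (by linarith) (by positivity)
    _ = 2 * K * h ^ 2 := by ring

end HybridMA

open HybridMA

theorem theorem4p1 (n : ℕ) (hn : 0 < n) (f g u : (Fin n → ℝ) → ℝ) (Ωr : Set (Fin n → ℝ))
    (hf : ContinuousOn f (HybridMA.closedCube n))
    (hfpos : ∀ x ∈ HybridMA.closedCube n, 0 < f x)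
    (hg : ContinuousOn g (HybridMA.cubeBoundary n))
    (hgext : ∃ G : (Fin n → ℝ) → ℝ, ContinuousOn G (HybridMA.closedCube n) ∧
      ConvexOn ℝ (HybridMA.closedCube n) G ∧ ∀ x ∈ HybridMA.cubeBoundary n, G x = g x)
    (hu : HybridMA.IsViscositySolution f g u)
    (hΩr : IsOpen Ωr) (hΩrsub : Ωr ⊆ HybridMA.openCube n) (hreg : ContDiffOn ℝ 2 u Ωr)
    (K : ℝ) (hK : 0 < K) :
    ∃ C : ℝ, 0 < C ∧ ∃ h₀ : ℝ, 0 < h₀ ∧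
      ∀ h : ℝ, HybridMA.IsMeshSize h → h < h₀ →
        ∀ v : HybridMA.Mesh n, HybridMA.IsHybridSolution h Ωr f g v →
          (v ∈ HybridMA.meshBall h Ωr g u (K * h ^ (2 + (n : ℝ) / 2)) →
            (∀ k ∈ HybridMA.gridInt n h, |v k| ≤ C) ∧
            (∀ k ∈ HybridMA.regInt h Ωr, |v k - HybridMA.restr h u k| ≤ C * h ^ 2)) ∧
          (∀ b : ℝ, 0 ≤ b → (∀ k ∈ HybridMA.regInt h Ωr, |v k| ≤ b) →
            ∀ k ∈ HybridMA.singInt h Ωr, |v k| ≤ b + C) := by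
  obtain ⟨G, hGc, -, hGg⟩ := hgext
  obtain ⟨B, hB, hGB⟩ := exists_abs_le_closedCube hGc
  obtain ⟨F, hF, hfF⟩ := exists_abs_le_closedCube hf
  obtain ⟨U, hU, huU⟩ := exists_abs_le_closedCube hu.continuousOn
  have hgB : ∀ x ∈ cubeBoundary n, |g x| ≤ B := fun x hx => hGg x hx ▸ hGB x hx.1
  have hFn : 0 ≤ F * n := by positivity
  have hsing : ∀ h : ℝ, IsMeshSize h → ∀ v : Mesh n, IsHybridSolution h Ωr f g v →
      ∀ b : ℝ, 0 ≤ b → (∀ k ∈ regInt h Ωr, |v k| ≤ b) →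
      ∀ k ∈ singInt h Ωr, |v k| ≤ b + (B + (F + 1) * n) := fun h hh v hv b hb hvb k hk => by
    have hkg : k ∈ grid n h := openCube_subset_closedCube n hk.1
    rw [abs_le]
    constructor
    · linarith [IsHybridSolution.ge_of_mem_grid hn hh hv hb hB hF hvb hgB hfF hkg]
    · linarith [IsHybridSolution.le_of_mem_grid hn hh hv hb hB hvb hgB hkg]
  have hFn1 : 0 ≤ (F + 1) * n := by positivity
  -- `U + 2K` bounds `v` on `Ω_{r,0}^h` once `h ≤ 1`, and the rest is the barrier cost. The
  -- threshold 1 serves only to give `h² ≤ 1`.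
  refine ⟨U + 2 * K + (B + (F + 1) * n), by positivity, 1, one_pos, fun h hh hh1 v hv =>
    ⟨fun hball => ?_, fun b hb hvb k hk => ?_⟩⟩
  · have hclose := fun k (hk : k ∈ regInt h Ωr) =>
      abs_sub_restr_le_of_mem_meshBall hn hh hK.le hΩrsub hball hk
    have hsq : h ^ 2 ≤ 1 := pow_le_one₀ hh.1.le hh1.le
    have hreg' : ∀ k ∈ regInt h Ωr, |v k| ≤ U + 2 * K := fun k hk => by
      have h1 : |restr h u k| ≤ U :=
        huU _ (regGrid_subset_grid hΩrsub (regInt_subset_regGrid hk))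
      have h2 := abs_sub_abs_le_abs_sub (v k) (restr h u k)
      have h3 := mul_le_mul_of_nonneg_left hsq (by positivity : 0 ≤ 2 * K)
      linarith [hclose k hk]
    refine ⟨fun k hk => ?_, fun k hk => (hclose k hk).trans ?_⟩
    · by_cases hr : k ∈ regInt h Ωr
      · linarith [hreg' k hr]
      · exact hsing h hh v hv _ (by positivity) hreg' k ⟨hk, hr⟩
    · exact mul_le_mul_of_nonneg_right (by linarith) (sq_nonneg h)
  · linarith [hsing h hh v hv b hb hvb k hk]
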